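/- Let $K$ be a field of differential functions $f=f(x,u,u_1,\dots,u_m)$: a field containing $x$ and the jet variables $u=u_0,u_1,u_2,\dots$ (with $u_i=\partial_x^i u$), equipped with commuting derivations $\partial/\partial x,\ \partial/\partial u_i$ that take the obvious values on $x$ and the $u_j$, and such that every $f\in K$ satisfies $\partial f/\partial u_i\ne 0$ for only finitely many $i$; for example the field of rational functions in $x,u,u_1,u_2,\dots$ over a field of constants. Let $D_x=\partial_x+\sum_{i\ge 0}u_{i+1}\,\partial/\partial u_i$. On solutions of $u_t=F$ with $F\in K$ put $D_t=\sum_{i\ge0}D_x^i(F)\,\partial/\partial u_i$. The Fréchet derivative of $F$ is $D_F=\sum_{i\ge0}\frac{\partial F}{\partial u_i}D_x^i$, and that of the equation $\Delta=F-u_t=0$ is $D_\Delta=-D_t+D_F$. A function $Q\in K$ is a generalized symmetry of $u_t=F$ if $\sum_{i\ge 0} D_x^i(Q)\,\partial F/\partial u_i=D_t(Q)$. The order of $f\in K$ is the largest $i$ with $\partial f/\partial u_i\neq0$. Consider the equation $u_t=u^2u_2$ and the pseudo-differential operator $$\mathcal R=u\,D_x+u^2u_2\,D_x^{-1}\cdot\frac1{u^2}.$$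 Then the following hold. 1. The Fréchet derivative of the equation is $D_\Delta=-D_t+u^2D_x^2+2uu_2$, and $\mathcal R$ commutes with it on solutions: $D_\Delta\cdot\mathcal R=\mathcal R\cdot D_\Delta$ as formal pseudo-differential operators, that is, as formal series in $D_t$ whose coefficients are formal series $\sum_{i\le m}a_iD_x^i$ with $a_i\in K$, multiplied according to $D_x\cdot a=aD_x+D_x(a)$, $D_t\cdot a=aD_t+D_t(a)$ for $a\in K$, and $D_tD_x=D_xD_t$. 2. $\mathcal R$ is a recursion operator with root $u^2u_2$ for this equation. That is, start from $Q_1=u^2u_2$ and set $Q_{j+1}=\mathcal R\,Q_j$, where $D_x^{-1}f$ denotes any $h\in K$ with $D_xh=f$. Then at each step, whichever antiderivatives were chosen before, the required antiderivative exists in $K$, and all the functions $Q_j$ obtained are generalized symmetries of $u_t=u^2u_2$. 3. The characteristics have strictly increasing orders: $\operatorname{ord}Q_1<\operatorname{ord}Q_2<\cdots$ for every such sequence. The values of $\mathcal R\,Q_1$ are exactly $$Q_2=u^2(3u_1u_2+u\,u_3)+c\,u^2u_2,\qquad c\in K,\ D_xc=0,$$ so that $Q_2=u^2(3u_1u_2+uu_3)$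 when the constant of integration is taken to be zero. -/

import Mathlib

/-!
Differential functions of `x, u, u₁, u₂, …`, total derivatives, generalized symmetries, formal
pseudo-differential operators, and recursion operators of an evolution equation `u_t = F`.
-/

/-- A field `K` of differential functions `f = f(x, u, u₁, …, u_m)`: it contains the independent
variable `x` and the jet variables `u 0 = u, u 1 = u_x, u 2 = u_xx, …`, it carries the commuting
partial derivatives with respect to all these variables, and each of its elements depends on finitely
many of the variables only. -/
class DiffFunField (K : Type*) [Field K] where
  /-- the independent variable -/
  x : K
  /-- the jet variables -/
  u : ℕ → K
  /-- `∂/∂x` -/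
  pdx : Derivation ℤ K K
  /-- `∂/∂uᵢ` -/
  pd : ℕ → Derivation ℤ K K
  pdx_x : pdx x = 1
  pdx_u : ∀ j, pdx (u j) = 0
  pd_x : ∀ i, pd i x = 0
  pd_u : ∀ i j, pd i (u j) = if i = j then 1 else 0
  pdx_pd_comm : ∀ i f, pdx (pd i f) = pd i (pdx f)
  pd_comm : ∀ i j f, pd i (pd j f) = pd j (pd i f)
  finite_pd : ∀ f, {i | pd i f ≠ 0}.Finite

namespace DiffFunField

section Jets

variable {K : Type*} [Field K] [DiffFunField K]

theorem finite_support_mul_pd (a : ℕ → K) (f : K) :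
    (Function.support fun i => a i * pd i f).Finite :=
  (finite_pd f).subset fun i hi h => hi (by simp [h])

/-- The vector field `∑ᵢ aᵢ ∂/∂uᵢ`. -/
noncomputable def vertical (a : ℕ → K) : Derivation ℤ K K :=
  Derivation.mk'
    (AddMonoidHom.toIntLinearMap
      { toFun := fun f => ∑ᶠ i, a i * pd i f
        map_zero' := by simp
        map_add' := fun f g => by
          rw [← finsum_add_distrib (finite_support_mul_pd a f) (finite_support_mul_pd a g)]
          simp [mul_add] })
    (fun f g => by
      have hf := finite_support_mul_pd a f
      have hg := finite_support_mul_pd a g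
      change ∑ᶠ i, a i * pd i (f * g) = f * ∑ᶠ i, a i * pd i g + g * ∑ᶠ i, a i * pd i f
      rw [mul_finsum, mul_finsum, ← finsum_add_distrib]
      · refine finsum_congr fun i => ?_
        rw [Derivation.leibniz, smul_eq_mul, smul_eq_mul]
        ring
      · exact hg.subset fun i hi h => hi (by simp only [h, mul_zero])
      · exact hf.subset fun i hi h => hi (by simp only [h, mul_zero]))

theorem vertical_apply (a : ℕ → K) (f : K) : vertical a f = ∑ᶠ i, a i * pd i f := rfl

variable (K) in
/-- The total derivative `D_x = ∂/∂x + ∑ᵢ uᵢ₊₁ ∂/∂uᵢ`. -/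
noncomputable def Dx : Derivation ℤ K K := pdx + vertical fun i => u (i + 1)

/-- The prolonged evolutionary vector field `P^Q = ∑ᵢ D_xⁱ(Q) ∂/∂uᵢ`. -/
noncomputable def prolong (Q : K) : Derivation ℤ K K := vertical fun i => (Dx K)^[i] Q

/-- The total `t`-derivative on the solutions of `u_t = F`, on functions that do not depend
explicitly on `t`: it replaces `∂_xⁱ u_t` by `D_xⁱ(F)`, so `D_t = ∑ᵢ D_xⁱ(F) ∂/∂uᵢ`. -/
noncomputable def Dt (F : K) : Derivation ℤ K K := vertical fun i => (Dx K)^[i] F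

/-- `Q` is (the characteristic of) a generalized symmetry of `Δ = F - u_t = 0`: the function
`P^Q(Δ) = P^Q(F) - D_t(Q)` vanishes on the solutions of `u_t = F`. -/
def IsSymmetry (F Q : K) : Prop := prolong Q F - Dt F Q = 0

/-- The order of a differential function: the largest `i` such that it depends on `uᵢ`
(and `⊥` for a function that depends on none of the `uᵢ`). -/
noncomputable def order (f : K) : WithBot ℕ := (finite_pd f).toFinset.max

end Jets

end DiffFunField

/-- Formal series `∑_{i ≤ m} aᵢ ∂ⁱ`, `m ∈ ℤ`, with coefficients `aᵢ` in a ring `A`, where the symbol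
`∂` acts on `A` through the additive map `δ` (a derivation of `A` in all uses below). -/
@[ext]
structure FormalOp (A : Type*) [NonUnitalNonAssocRing A] (δ : A →+ A) where
  coeff : ℤ → A
  bounded : ∃ m : ℤ, ∀ i, m < i → coeff i = 0

namespace FormalOp

variable {A : Type*} [NonUnitalNonAssocRing A] {δ : A →+ A}

instance : Zero (FormalOp A δ) := ⟨⟨fun _ => 0, 0, fun _ _ => rfl⟩⟩

instance : Add (FormalOp A δ) :=
  ⟨fun S T => ⟨fun i => S.coeff i + T.coeff i, by
    obtain ⟨m, hm⟩ := S.bounded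
    obtain ⟨n, hn⟩ := T.bounded
    exact ⟨max m n, fun i hi => by
      rw [hm i (lt_of_le_of_lt (le_max_left _ _) hi),
        hn i (lt_of_le_of_lt (le_max_right _ _) hi), add_zero]⟩⟩⟩

instance : Neg (FormalOp A δ) :=
  ⟨fun S => ⟨fun i => -S.coeff i, by
    obtain ⟨m, hm⟩ := S.bounded
    exact ⟨m, fun i hi => by rw [hm i hi, neg_zero]⟩⟩⟩

/-- The terms of `S T` at `∂ᵐ`, indexed by `(i, p)`, for the composition rule
`(a ∂ⁱ)(b ∂ʲ) = ∑_{p ≥ 0} (i choose p) a δᵖ(b) ∂ⁱ⁺ʲ⁻ᵖ`. -/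
def mulTerm (S T : FormalOp A δ) (m : ℤ) (s : ℤ × ℕ) : A :=
  Ring.choose s.1 s.2 • (S.coeff s.1 * δ^[s.2] (T.coeff (m - s.1 + s.2)))

theorem mulTerm_eq_zero {S T : FormalOp A δ} {a b : ℤ} (ha : ∀ i, a < i → S.coeff i = 0)
    (hb : ∀ i, b < i → T.coeff i = 0) (m : ℤ) (s : ℤ × ℕ)
    (h : a < s.1 ∨ b < m - s.1 + s.2) : mulTerm S T m s = 0 := by
  rcases h with h | h
  · simp [mulTerm, ha _ h]
  · simp [mulTerm, hb _ h, iterate_map_zero]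

theorem finite_support_mulTerm (S T : FormalOp A δ) (m : ℤ) :
    (Function.support (mulTerm S T m)).Finite := by
  obtain ⟨a, ha⟩ := S.bounded
  obtain ⟨b, hb⟩ := T.bounded
  refine ((Set.finite_Icc (m - b) a).prod (Set.finite_Iic (a + b - m).toNat)).subset ?_
  intro s hs
  by_contra hc
  apply hs
  apply mulTerm_eq_zero ha hb
  by_contra hn
  apply hc
  simp only [Set.mem_prod, Set.mem_Icc, Set.mem_Iic]
  omega

/-- Composition of formal series. -/
noncomputable instance : Mul (FormalOp A δ) :=
  ⟨fun S T => ⟨fun m => ∑ᶠ s : ℤ × ℕ, mulTerm S T m s, by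
    obtain ⟨a, ha⟩ := S.bounded
    obtain ⟨b, hb⟩ := T.bounded
    refine ⟨a + b, fun m hm => ?_⟩
    rw [finsum_eq_zero_of_forall_eq_zero]
    intro s
    apply mulTerm_eq_zero ha hb
    omega⟩⟩

theorem coeff_zero (i : ℤ) : (0 : FormalOp A δ).coeff i = 0 := rfl

theorem coeff_add (S T : FormalOp A δ) (i : ℤ) : (S + T).coeff i = S.coeff i + T.coeff i := rfl

theorem coeff_neg (S : FormalOp A δ) (i : ℤ) : (-S).coeff i = -S.coeff i := rfl

theorem coeff_mul (S T : FormalOp A δ) (m : ℤ) :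
    (S * T).coeff m = ∑ᶠ s : ℤ × ℕ, mulTerm S T m s := rfl

noncomputable instance : NonUnitalNonAssocRing (FormalOp A δ) where
  add_assoc _ _ _ := FormalOp.ext (funext fun _ => add_assoc _ _ _)
  zero_add _ := FormalOp.ext (funext fun _ => zero_add _)
  add_zero _ := FormalOp.ext (funext fun _ => add_zero _)
  add_comm _ _ := FormalOp.ext (funext fun _ => add_comm _ _)
  neg_add_cancel _ := FormalOp.ext (funext fun _ => neg_add_cancel _)
  nsmul := nsmulRec
  zsmul := zsmulRec
  left_distrib S T U := by
    ext m
    rw [coeff_add, coeff_mul, coeff_mul, coeff_mul,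
      ← finsum_add_distrib (finite_support_mulTerm S T m) (finite_support_mulTerm S U m)]
    refine finsum_congr fun s => ?_
    simp only [mulTerm, coeff_add, iterate_map_add, mul_add, smul_add]
  right_distrib S T U := by
    ext m
    rw [coeff_add, coeff_mul, coeff_mul, coeff_mul,
      ← finsum_add_distrib (finite_support_mulTerm S U m) (finite_support_mulTerm T U m)]
    refine finsum_congr fun s => ?_
    simp only [mulTerm, coeff_add, add_mul, smul_add]
  zero_mul S := by
    ext m
    rw [coeff_mul, coeff_zero]
    exact finsum_eq_zero_of_forall_eq_zero fun s => by simp [mulTerm, coeff_zero]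
  mul_zero S := by
    ext m
    rw [coeff_mul, coeff_zero]
    exact finsum_eq_zero_of_forall_eq_zero fun s => by
      simp [mulTerm, coeff_zero, iterate_map_zero]

/-- The monomial `a ∂ⁱ`. -/
def single (i : ℤ) (a : A) : FormalOp A δ where
  coeff j := if j = i then a else 0
  bounded := ⟨i, fun _ hj => if_neg hj.ne'⟩

/-- A map of `A` applied to all coefficients. -/
def mapCoeff (d : A →+ A) : FormalOp A δ →+ FormalOp A δ where
  toFun S := ⟨fun i => d (S.coeff i), by
    obtain ⟨m, hm⟩ := S.bounded
    exact ⟨m, fun i hi => by rw [hm i hi, map_zero]⟩⟩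
  map_zero' := FormalOp.ext (funext fun _ => map_zero d)
  map_add' _ _ := FormalOp.ext (funext fun _ => map_add d _ _)

end FormalOp

namespace DiffFunField

section Model

variable {A : Type*} [CommRing A] {K : Type*} [Field K] [Algebra A K]

variable (K) in
/-- The ring homomorphism `a ↦ a + ε d(a)` into the dual numbers. -/
noncomputable def dualHomAux (d : Derivation ℤ A A) : A →+* TrivSqZeroExt K K where
  toFun a := TrivSqZeroExt.inl (algebraMap A K a) + TrivSqZeroExt.inr (algebraMap A K (d a))
  map_zero' := by
    rw [map_zero, map_zero, map_zero, TrivSqZeroExt.inl_zero, TrivSqZeroExt.inr_zero, add_zero]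
  map_one' := by
    rw [Derivation.map_one_eq_zero, map_one, map_zero, TrivSqZeroExt.inl_one,
      TrivSqZeroExt.inr_zero, add_zero]
  map_add' a b := by
    rw [map_add, map_add, map_add, TrivSqZeroExt.inl_add, TrivSqZeroExt.inr_add]
    abel
  map_mul' a b := by
    apply TrivSqZeroExt.ext
    · simp only [TrivSqZeroExt.fst_add, TrivSqZeroExt.fst_mul, TrivSqZeroExt.fst_inl,
        TrivSqZeroExt.fst_inr, add_zero, map_mul]
    · simp only [TrivSqZeroExt.snd_add, TrivSqZeroExt.snd_mul, TrivSqZeroExt.snd_inl,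
        TrivSqZeroExt.snd_inr, TrivSqZeroExt.fst_add, TrivSqZeroExt.fst_inl,
        TrivSqZeroExt.fst_inr, add_zero, zero_add, op_smul_eq_smul, smul_eq_mul,
        Derivation.leibniz, map_add, map_mul]

theorem fst_dualHomAux (d : Derivation ℤ A A) (a : A) :
    (dualHomAux K d a).fst = algebraMap A K a :=
  add_zero (algebraMap A K a)

theorem snd_dualHomAux (d : Derivation ℤ A A) (a : A) :
    (dualHomAux K d a).snd = algebraMap A K (d a) :=
  zero_add (algebraMap A K (d a))

variable [IsFractionRing A K]

variable (K) in
/-- The extension of `a ↦ a + ε d(a)` to fractions. -/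
noncomputable def dualHom (d : Derivation ℤ A A) : K →+* TrivSqZeroExt K K :=
  IsLocalization.lift (M := nonZeroDivisors A) (g := dualHomAux K d) (fun y => by
    rw [TrivSqZeroExt.isUnit_iff_isUnit_fst, fst_dualHomAux]
    exact IsLocalization.map_units K y)

theorem dualHom_algebraMap (d : Derivation ℤ A A) (a : A) :
    dualHom K d (algebraMap A K a) = dualHomAux K d a :=
  IsLocalization.lift_eq _ a

theorem fst_dualHom (d : Derivation ℤ A A) (f : K) : (dualHom K d f).fst = f := by
  have h : (TrivSqZeroExt.fstHom K K K).toRingHom.comp (dualHom K d) = RingHom.id _ := by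
    apply IsLocalization.ringHom_ext (nonZeroDivisors A)
    ext a
    change (dualHom K d (algebraMap A K a)).fst = algebraMap A K a
    rw [dualHom_algebraMap, fst_dualHomAux]
  exact RingHom.congr_fun h f

variable (K) in
/-- The extension of a derivation to the field of fractions by the quotient rule. -/
noncomputable def fracDer (d : Derivation ℤ A A) : Derivation ℤ K K :=
  Derivation.mk'
    (AddMonoidHom.toIntLinearMap
      { toFun := fun f => (dualHom K d f).snd
        map_zero' := by simp
        map_add' := fun f g => by simp })
    (fun f g => by
      change (dualHom K d (f * g)).snd = f * (dualHom K d g).snd + g * (dualHom K d f).snd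
      rw [map_mul, TrivSqZeroExt.snd_mul, fst_dualHom, fst_dualHom]
      simp [mul_comm])

theorem fracDer_algebraMap (d : Derivation ℤ A A) (a : A) :
    fracDer K d (algebraMap A K a) = algebraMap A K (d a) := by
  change (dualHom K d (algebraMap A K a)).snd = _
  rw [dualHom_algebraMap, snd_dualHomAux]

theorem fracDer_mk' (d : Derivation ℤ A A) (a : A) (b : nonZeroDivisors A)
    (ha' : d a = 0) (hb' : d b = 0) : fracDer K d (IsLocalization.mk' K a b) = 0 := by
  have hb : algebraMap A K b ≠ 0 := (IsLocalization.map_units K b).ne_zero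
  have h := congrArg (fracDer K d) (IsLocalization.mk'_spec K a b)
  rw [Derivation.leibniz, fracDer_algebraMap, fracDer_algebraMap, ha', hb'] at h
  simpa [hb] using h

theorem derivation_ext_frac {D E : Derivation ℤ K K}
    (h : ∀ a : A, D (algebraMap A K a) = E (algebraMap A K a)) : D = E := by
  ext f
  obtain ⟨a, b, rfl⟩ := IsLocalization.exists_mk'_eq (nonZeroDivisors A) f
  have hb : algebraMap A K b ≠ 0 := (IsLocalization.map_units K b).ne_zero
  have h1 := congrArg D (IsLocalization.mk'_spec K a b)
  have h2 := congrArg E (IsLocalization.mk'_spec K a b)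
  rw [Derivation.leibniz] at h1 h2
  rw [h, h, ← h2] at h1
  simpa [hb] using h1

theorem fracDer_comm (d e : Derivation ℤ A A) (h : ∀ a, d (e a) = e (d a)) (f : K) :
    fracDer K d (fracDer K e f) = fracDer K e (fracDer K d f) := by
  have h1 : ⁅fracDer K d, fracDer K e⁆ = (0 : Derivation ℤ K K) := by
    apply derivation_ext_frac (A := A)
    intro a
    rw [Derivation.commutator_apply]
    simp [fracDer_algebraMap, h]
  have h2 := congrArg (fun D => D f) h1
  simpa [Derivation.commutator_apply, sub_eq_zero] using h2

theorem pderiv_comm {σ R : Type*} [CommRing R] (i j : σ) (p : MvPolynomial σ R) :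
    MvPolynomial.pderiv i (MvPolynomial.pderiv j p) =
      MvPolynomial.pderiv j (MvPolynomial.pderiv i p) := by
  classical
  have h1 : ⁅MvPolynomial.pderiv (R := R) i, MvPolynomial.pderiv j⁆ =
      (0 : Derivation R (MvPolynomial σ R) (MvPolynomial σ R)) := by
    apply MvPolynomial.derivation_ext
    intro k
    rw [Derivation.commutator_apply, MvPolynomial.pderiv_X, MvPolynomial.pderiv_X]
    by_cases h1 : k = j <;> by_cases h2 : k = i <;> simp [Pi.single_apply, h1, h2] <;>
      split_ifs <;> simp
  have h2 := congrArg (fun D => D p) h1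
  simpa [Derivation.commutator_apply, sub_eq_zero] using h2

/-- An additive map with the Leibniz rule as a derivation. -/
def intDer {B : Type*} [CommRing B] (d : B →+ B) (h : ∀ a b, d (a * b) = a • d b + b • d a) :
    Derivation ℤ B B :=
  Derivation.mk' d.toIntLinearMap h

theorem intDer_apply {B : Type*} [CommRing B] (d : B →+ B)
    (h : ∀ a b, d (a * b) = a • d b + b • d a) (p : B) : intDer d h p = d p := rfl

/-- A partial derivative as a `ℤ`-linear derivation. -/
noncomputable abbrev pderivInt {k : Type*} [CommRing k] (i : Option ℕ) :=
  intDer (B := MvPolynomial (Option ℕ) k) (MvPolynomial.pderiv i).toLinearMap.toAddMonoidHom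
    (fun a b => (MvPolynomial.pderiv i).leibniz a b)

theorem pderivInt_apply {k : Type*} [CommRing k] (i : Option ℕ) (p : MvPolynomial (Option ℕ) k) :
    pderivInt i p = MvPolynomial.pderiv i p := rfl

theorem pderivInt_comm {k : Type*} [CommRing k] (i j : Option ℕ)
    (p : MvPolynomial (Option ℕ) k) :
    pderivInt i (pderivInt j p) = pderivInt j (pderivInt i p) :=
  pderiv_comm i j p

theorem fracDer_pderivInt_X {k : Type*} [CommRing k] [Algebra (MvPolynomial (Option ℕ) k) K]
    [IsFractionRing (MvPolynomial (Option ℕ) k) K] (i j : Option ℕ) :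
    fracDer K (pderivInt (k := k) i)
        (algebraMap (MvPolynomial (Option ℕ) k) K (MvPolynomial.X j)) =
      if i = j then 1 else 0 := by
  refine (fracDer_algebraMap (pderivInt (k := k) i) (MvPolynomial.X j)).trans ?_
  rw [pderivInt_apply]
  split_ifs with h
  · rw [h, MvPolynomial.pderiv_X_self, map_one]
  · rw [MvPolynomial.pderiv_X_of_ne (Ne.symm h), map_zero]

/-- The field `K = k(x, u, u₁, u₂, …)` of rational differential functions over a field `k` of
constants is a field of differential functions. -/
@[reducible]
noncomputable def rationalFunctions (k K : Type*) [Field k] [Field K]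
    [Algebra (MvPolynomial (Option ℕ) k) K] [IsFractionRing (MvPolynomial (Option ℕ) k) K] :
    DiffFunField K where
  x := algebraMap (MvPolynomial (Option ℕ) k) _ (MvPolynomial.X none)
  u i := algebraMap (MvPolynomial (Option ℕ) k) _ (MvPolynomial.X (some i))
  pdx := fracDer K (pderivInt (k := k) none)
  pd i := fracDer K (pderivInt (k := k) (some i))
  pdx_x := (fracDer_pderivInt_X (k := k) none none).trans (if_pos rfl)
  pdx_u j := (fracDer_pderivInt_X (k := k) none (some j)).trans (if_neg (by simp))
  pd_x i := (fracDer_pderivInt_X (k := k) (some i) none).trans (if_neg (by simp))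
  pd_u i j := (fracDer_pderivInt_X (k := k) (some i) (some j)).trans (by simp)
  pdx_pd_comm i f :=
    fracDer_comm (pderivInt none) (pderivInt (some i)) (pderivInt_comm none (some i)) f
  pd_comm i j f :=
    fracDer_comm (pderivInt (some i)) (pderivInt (some j)) (pderivInt_comm (some i) (some j)) f
  finite_pd f := by
    classical
    obtain ⟨a, b, rfl⟩ := IsLocalization.exists_mk'_eq
      (nonZeroDivisors (MvPolynomial (Option ℕ) k)) f
    refine ((a.vars ∪ b.1.vars).finite_toSet.preimage
      (Option.some_injective ℕ).injOn).subset fun i hi => ?_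
    by_contra h
    simp only [Set.mem_preimage, Finset.mem_coe, Finset.mem_union, not_or] at h
    have ha : pderivInt (some i) a = 0 := MvPolynomial.pderiv_eq_zero_of_notMem_vars h.1
    have hb : pderivInt (some i) b.1 = 0 := MvPolynomial.pderiv_eq_zero_of_notMem_vars h.2
    exact hi (fracDer_mk' (pderivInt (some i)) a b ha hb)

end Model

section Operators

variable (K : Type*) [Field K] [DiffFunField K]

/-- Formal pseudo-differential operators: formal series in `D_x` with coefficients in `K`. -/
abbrev PseudoDiff : Type _ := FormalOp K (Dx K).toLinearMap.toAddMonoidHom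

variable {K}

/-- Operators in `D_x` and `D_t` on the solutions of `u_t = F`: formal series in `D_t` whose
coefficients are formal series in `D_x`. Here `[D_t, D_x] = 0` and `[D_t, f] = D_t(f)` for `f` in `K`,
that is, `[D_t, ∑ aᵢ D_xⁱ] = ∑ D_t(aᵢ) D_xⁱ`. -/
abbrev SolOp (F : K) : Type _ :=
  FormalOp (PseudoDiff K) (FormalOp.mapCoeff (Dt F).toLinearMap.toAddMonoidHom)

/-- The Fréchet derivative `∑ᵢ (∂H/∂uᵢ) D_xⁱ` of a differential function `H`. -/
noncomputable def frechet (H : K) : PseudoDiff K where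
  coeff i := if 0 ≤ i then pd i.toNat H else 0
  bounded := by
    obtain ⟨n, hn⟩ := (finite_pd H).bddAbove
    refine ⟨n, fun i hi => ?_⟩
    rw [if_pos (by omega)]
    by_contra h
    have := hn h
    omega

/-- The Fréchet derivative `D_Δ = -D_t + D_F` of `Δ = F - u_t`, as an operator on solutions. -/
noncomputable def frechetEq (F : K) : SolOp F :=
  -FormalOp.single 1 (FormalOp.single 0 1) + FormalOp.single 0 (frechet F)

variable (K) in
/-- Pseudo-differential expressions, built from multiplications by functions, `D_x` and `D_x⁻¹`
with sums and compositions. -/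
inductive Expr : Type _
  | fn (f : K)
  | dx
  | dxInv
  | add (S T : Expr)
  | comp (S T : Expr)

/-- The formal pseudo-differential operator that an expression denotes. -/
noncomputable def Expr.toOp : Expr K → PseudoDiff K
  | .fn f => FormalOp.single 0 f
  | .dx => FormalOp.single 1 1
  | .dxInv => FormalOp.single (-1) 1
  | .add S T => S.toOp + T.toOp
  | .comp S T => S.toOp * T.toOp

/-- `R.Acts Q Q'`: the differential function `Q'` is a value of `R Q`. As `D_x⁻¹ f` stands for any
differential function `h` with `D_x h = f`, an expression may have several values or none. -/
def Expr.Acts : Expr K → K → K → Prop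
  | .fn f, Q, Q' => Q' = f * Q
  | .dx, Q, Q' => Q' = Dx K Q
  | .dxInv, Q, Q' => Dx K Q' = Q
  | .add S T, Q, Q' => ∃ a b, S.Acts Q a ∧ T.Acts Q b ∧ Q' = a + b
  | .comp S T, Q, Q' => ∃ a, T.Acts Q a ∧ S.Acts a Q'

/-- `R` is a recursion operator with root `Q₁` for `u_t = F`: repeated application of `R` to `Q₁`
never breaks down and yields generalized symmetries only, whichever antiderivatives are chosen. -/
def IsRecursionOperator (F : K) (R : Expr K) (Q₁ : K) : Prop :=
  ∀ Q, Relation.ReflTransGen R.Acts Q₁ Q → IsSymmetry F Q ∧ ∃ Q', R.Acts Q Q'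

variable (K) in
/-- The expression `u D_x + u² u₂ D_x⁻¹ · (1/u²)`. -/
def recOp : Expr K :=
  .add (.comp (.fn (u 0)) .dx) (.comp (.fn (u 0 ^ 2 * u 2)) (.comp .dxInv (.fn (1 / u 0 ^ 2))))

end Operators

end DiffFunField

open DiffFunField

/-!
Write `P = u² D_x`, `T = D_x ∘ u` and `L = D_x u² D_x`. Then `R P = P T`, that is, `R = P T P⁻¹`,
and on solutions `[D_t, P] = D_F P - P L` and `[D_t, T] = [L, T]`, where `F = u² u₂`. So conjugation
by `P` turns the Lax equation of `T` into `[D_t, R] = [D_F, R]`, which says that `R` commutes with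
`D_Δ = -D_t + D_F`.

On functions, `R` maps `u² D_x w` to `u² D_x (D_x (u w))`, where `w` is determined up to a constant.
If `w_t = D_x (u² D_x w)`, then `u² D_x w` is a symmetry, and both `w + c` and `D_x (u w)` solve the
same equation, so the recursion never breaks down. It starts from `w = u₁`, and each `D_x (u w)` is
of order one more than `w`.
-/

namespace DiffFunField

section JetCalculus

variable {K : Type*} [Field K] [DiffFunField K]

theorem exists_forall_ge_pd_eq_zero (f : K) : ∃ N, ∀ i, N ≤ i → pd i f = 0 := by
  obtain ⟨n, hn⟩ := (finite_pd f).bddAbove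
  exact ⟨n + 1, fun i hi => by_contra fun h => absurd (hn h) (by omega)⟩

theorem vertical_eq_sum (a : ℕ → K) {f : K} {N : ℕ} (hN : ∀ i, N ≤ i → pd i f = 0) :
    vertical a f = ∑ i ∈ Finset.range N, a i * pd i f := by
  refine finsum_eq_sum_of_support_subset _ fun i hi => ?_
  by_contra h
  exact hi (by simp [hN i (by simpa using h)])

theorem vertical_u (a : ℕ → K) (j : ℕ) : vertical a (u j) = a j := by
  rw [vertical_apply, finsum_eq_single _ j fun i hi => by simp [pd_u, hi]]
  simp [pd_u]

theorem vertical_single_one (n : ℕ) (f : K) : vertical (Pi.single n 1) f = pd n f := by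
  rw [vertical_apply, finsum_eq_single _ n fun i hi => by simp [hi]]
  simp

theorem Dx_apply (f : K) : Dx K f = pdx f + vertical (fun i => u (i + 1)) f := rfl

theorem Dx_u (j : ℕ) : Dx K (u j) = u (j + 1) := by
  rw [Dx_apply, pdx_u, vertical_u, zero_add]

theorem vertical_Dx (a : ℕ → K) (f : K) :
    vertical a (Dx K f) = Dx K (vertical a f) + vertical (fun i => a (i + 1) - Dx K (a i)) f := by
  obtain ⟨N, hN⟩ := exists_forall_ge_pd_eq_zero f
  have hpdx : ∀ i, N ≤ i → pd i (pdx f) = 0 := fun i hi => by rw [← pdx_pd_comm, hN i hi, map_zero]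
  have hpd : ∀ j i, N ≤ i → pd i (pd j f) = 0 := fun j i hi => by rw [pd_comm, hN i hi, map_zero]
  have hswap : ∑ j ∈ Finset.range N, u (j + 1) * ∑ i ∈ Finset.range N, a i * pd i (pd j f) =
      ∑ i ∈ Finset.range N, a i * ∑ j ∈ Finset.range N, u (j + 1) * pd j (pd i f) := by
    simp only [Finset.mul_sum]
    rw [Finset.sum_comm]
    refine Finset.sum_congr rfl fun i _ => Finset.sum_congr rfl fun j _ => ?_
    rw [pd_comm]
    ring
  have hleft : vertical a (Dx K f) = ∑ i ∈ Finset.range N, a i * pdx (pd i f) +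
      (∑ j ∈ Finset.range N, u (j + 1) * ∑ i ∈ Finset.range N, a i * pd i (pd j f) +
        ∑ j ∈ Finset.range N, pd j f * a (j + 1)) := by
    rw [Dx_apply, map_add, vertical_eq_sum a hpdx, vertical_eq_sum _ hN, map_sum]
    simp only [Derivation.leibniz, smul_eq_mul, vertical_u, vertical_eq_sum a (hpd _),
      Finset.sum_add_distrib, pdx_pd_comm]
  have hright : Dx K (vertical a f) = ∑ i ∈ Finset.range N, a i * pdx (pd i f) +
      ∑ i ∈ Finset.range N, a i * ∑ j ∈ Finset.range N, u (j + 1) * pd j (pd i f) +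
        ∑ i ∈ Finset.range N, pd i f * Dx K (a i) := by
    rw [vertical_eq_sum a hN, map_sum]
    simp only [Derivation.leibniz, smul_eq_mul, Dx_apply (pd _ f), vertical_eq_sum _ (hpd _),
      Finset.sum_add_distrib, mul_add]
  rw [hleft, hright, hswap, vertical_eq_sum _ hN]
  simp only [sub_mul, Finset.sum_sub_distrib, mul_comm (pd _ f)]
  ring

theorem pd_zero_Dx (f : K) : pd 0 (Dx K f) = Dx K (pd 0 f) := by
  rw [← vertical_single_one, vertical_Dx, vertical_single_one, add_eq_left, vertical_apply]
  refine finsum_eq_zero_of_forall_eq_zero fun i => ?_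
  cases i <;> simp

theorem pd_succ_Dx (n : ℕ) (f : K) : pd (n + 1) (Dx K f) = pd n f + Dx K (pd (n + 1) f) := by
  have hcoeff : (fun i => (Pi.single (n + 1) 1 : ℕ → K) (i + 1) -
      Dx K ((Pi.single (n + 1) 1 : ℕ → K) i)) = Pi.single n 1 := by
    funext i
    have hDx : Dx K ((Pi.single (n + 1) 1 : ℕ → K) i) = 0 := by
      rw [Pi.single_apply]
      split_ifs <;> simp
    rw [hDx, sub_zero, Pi.single_apply, Pi.single_apply]
    simp
  rw [← vertical_single_one, vertical_Dx, hcoeff, vertical_single_one, vertical_single_one,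
    add_comm]

theorem Dt_Dx (F f : K) : Dt F (Dx K f) = Dx K (Dt F f) := by
  refine (vertical_Dx _ f).trans (add_eq_left.2 ?_)
  rw [vertical_apply]
  exact finsum_eq_zero_of_forall_eq_zero fun i => by
    rw [Function.iterate_succ_apply', sub_self, zero_mul]

theorem Dt_u (F : K) (j : ℕ) : Dt F (u j) = (Dx K)^[j] F := vertical_u _ j

theorem u_ne_zero (j : ℕ) : (u j : K) ≠ 0 := fun h => by
  simpa [h] using pd_u (K := K) j j

end JetCalculus

section Order

variable {K : Type*} [Field K] [DiffFunField K]

theorem order_le_iff {f : K} {b : WithBot ℕ} : order f ≤ b ↔ ∀ i : ℕ, b < i → pd i f = 0 := by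
  simp only [order, Finset.max_le_iff, Set.Finite.mem_toFinset, Set.mem_ofPred_eq]
  exact forall_congr' fun i => by rw [← not_imp_not, not_le, not_not]; exact Iff.rfl

theorem pd_eq_zero_of_order_lt {f : K} {i : ℕ} (h : order f < i) : pd i f = 0 :=
  order_le_iff.1 le_rfl i h

theorem order_eq_coe_iff {f : K} {n : ℕ} :
    order f = n ↔ pd n f ≠ 0 ∧ ∀ i, n < i → pd i f = 0 := by
  constructor
  · intro h
    refine ⟨by simpa using Finset.mem_of_max h, fun i hi => order_le_iff.1 h.le i ?_⟩
    exact_mod_cast hi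
  · rintro ⟨hn, hlt⟩
    refine le_antisymm (order_le_iff.2 fun i hi => hlt i (by exact_mod_cast hi)) ?_
    exact Finset.le_max (by simpa using hn)

theorem order_eq_bot_iff {f : K} : order f = ⊥ ↔ ∀ i, pd i f = 0 := by
  rw [← le_bot_iff, order_le_iff]
  simp

theorem order_u (n : ℕ) : order (u n : K) = n :=
  order_eq_coe_iff.2 ⟨by simp [pd_u], fun i hi => by simp [pd_u, hi.ne']⟩

theorem order_mul_le (f g : K) : order (f * g) ≤ max (order f) (order g) :=
  order_le_iff.2 fun i hi => by
    obtain ⟨hf, hg⟩ := max_lt_iff.1 hi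
    rw [Derivation.leibniz, pd_eq_zero_of_order_lt hf, pd_eq_zero_of_order_lt hg, smul_zero,
      smul_zero, add_zero]

theorem order_mul_of_order_lt {f g : K} (hf : f ≠ 0) (h : order f < order g) :
    order (f * g) = order g := by
  obtain ⟨n, hn⟩ := WithBot.ne_bot_iff_exists.1 (bot_le.trans_lt h).ne'
  refine le_antisymm ((order_mul_le f g).trans_eq (max_eq_right h.le)) ?_
  rw [← hn] at h ⊢
  refine Finset.le_max ?_
  have hg : pd n g ≠ 0 := (order_eq_coe_iff.1 hn.symm).1
  simpa [Derivation.leibniz, pd_eq_zero_of_order_lt h] using ⟨hf, hg⟩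

theorem order_Dx (f : K) : order (Dx K f) = order f + 1 := by
  cases h : order f with
  | bot =>
    have hf := order_eq_bot_iff.1 h
    refine order_eq_bot_iff.2 fun i => ?_
    cases i <;> simp [pd_zero_Dx, pd_succ_Dx, hf]
  | coe n =>
    obtain ⟨hn, hlt⟩ := order_eq_coe_iff.1 h
    change order (Dx K f) = ((n + 1 : ℕ) : WithBot ℕ)
    refine order_eq_coe_iff.2 ⟨?_, fun i hi => ?_⟩
    · rwa [pd_succ_Dx, hlt (n + 1) n.lt_succ_self, map_zero, add_zero]
    · obtain ⟨i, rfl⟩ := Nat.exists_eq_add_one_of_ne_zero (Nat.ne_zero_of_lt hi)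
      rw [pd_succ_Dx, hlt i (by omega), hlt (i + 1) (by omega), map_zero, add_zero]

theorem pd_eq_zero_of_Dx_eq_zero {c : K} (hc : Dx K c = 0) (i : ℕ) : pd i c = 0 := by
  have hbot : order c + 1 = ⊥ := by
    rw [← order_Dx, hc, order_eq_bot_iff]
    exact fun j => map_zero _
  exact order_eq_bot_iff.1 (by simpa using hbot) i

theorem Dt_eq_zero_of_Dx_eq_zero (F : K) {c : K} (hc : Dx K c = 0) : Dt F c = 0 :=
  finsum_eq_zero_of_forall_eq_zero fun i => by rw [pd_eq_zero_of_Dx_eq_zero hc, mul_zero]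

end Order

end DiffFunField

theorem finsum_prod_nat_eq_zero_add {α M : Type*} [AddCommMonoid M] {f : α × ℕ → M}
    (hf : f.support.Finite) :
    ∑ᶠ s, f s = ∑ᶠ i, f (i, 0) + ∑ᶠ s : α × ℕ, f (s.1, s.2 + 1) := by
  have hzero : Function.Injective fun i : α => (i, 0) := Prod.mk_left_injective 0
  have hsucc : Function.Injective fun s : α × ℕ => (s.1, s.2 + 1) :=
    Function.injective_id.prodMap (add_left_injective 1)
  have hunion : (Set.univ : Set (α × ℕ)) =
      Set.range (fun i : α => (i, 0)) ∪ Set.range fun s : α × ℕ => (s.1, s.2 + 1) := by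
    ext ⟨i, _ | p⟩ <;> simp
  have hdisj : Disjoint (Set.range fun i : α => (i, 0))
      (Set.range fun s : α × ℕ => (s.1, s.2 + 1)) := by
    rw [Set.disjoint_left]
    rintro _ ⟨i, rfl⟩ ⟨s, hs⟩
    simp at hs
  rw [← finsum_mem_univ, hunion, finsum_mem_union' hdisj (hf.inter_of_right _)
    (hf.inter_of_right _), finsum_mem_range hzero, finsum_mem_range hsucc]

namespace FormalOp

/-- The Leibniz rule for an additive map of a ring that need not be commutative, where Mathlib's
`Derivation` is not available. -/
def IsLeibniz {A : Type*} [NonUnitalNonAssocRing A] (δ : A →+ A) : Prop :=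
  ∀ a b, δ (a * b) = δ a * b + a * δ b

theorem IsLeibniz.map_one {A : Type*} [NonAssocRing A] {δ : A →+ A} (hδ : IsLeibniz δ) :
    δ 1 = 0 := by
  simpa using hδ 1 1

/-- If `δ P = M P - P L`, then conjugation by `P` turns solutions `T` of the Lax equation
`δ T = [L, T]` into solutions `R` of `δ R = [M, R]`. -/
theorem IsLeibniz.eq_commutator_of_intertwine {A : Type*} [Ring A] {δ : A →+ A}
    (hδ : IsLeibniz δ) {L M P P' R T : A} (hPP' : P * P' = 1) (hP : δ P = M * P - P * L)
    (hT : δ T = L * T - T * L) (hRP : R * P = P * T) : δ R = M * R - R * M := by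
  have hmul : δ R * P = (M * R - R * M) * P := by
    have h := congrArg δ hRP
    rw [hδ, hδ, hP, hT] at h
    calc δ R * P = (M * P - P * L) * T + P * (L * T - T * L) - R * (M * P - P * L) :=
          eq_sub_of_add_eq h
      _ = M * (P * T) - P * T * L - R * M * P + R * P * L := by noncomm_ring
      _ = (M * R - R * M) * P := by rw [hRP, ← hRP]; noncomm_ring
  calc δ R = δ R * P * P' := by rw [mul_assoc, hPP', mul_one]
    _ = M * R - R * M := by rw [hmul, mul_assoc, hPP', mul_one]

theorem isLeibniz_derivation {A : Type*} [CommRing A] (d : Derivation ℤ A A) :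
    IsLeibniz d.toLinearMap.toAddMonoidHom := fun a b => by
  refine (d.leibniz a b).trans ?_
  rw [smul_eq_mul, smul_eq_mul, add_comm, mul_comm b]
  rfl

section NonUnitalNonAssoc

variable {A : Type*} [NonUnitalNonAssocRing A] {δ : A →+ A}

theorem coeff_single (i : ℤ) (a : A) (j : ℤ) :
    (single i a : FormalOp A δ).coeff j = if j = i then a else 0 := rfl

theorem coeff_mapCoeff (e : A →+ A) (S : FormalOp A δ) (i : ℤ) :
    (mapCoeff e S).coeff i = e (S.coeff i) := rfl

theorem mapCoeff_single (e : A →+ A) (i : ℤ) (a : A) :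
    mapCoeff e (single i a : FormalOp A δ) = single i (e a) := by
  ext j
  rw [coeff_mapCoeff, coeff_single, coeff_single, apply_ite e, map_zero]

theorem single_zero_right (i : ℤ) : (single i 0 : FormalOp A δ) = 0 := by
  ext j
  rw [coeff_single, ite_self, coeff_zero]

theorem coeff_sum_single (s : Finset ℤ) (a : ℤ → A) (j : ℤ) :
    (∑ i ∈ s, single i (a i) : FormalOp A δ).coeff j = if j ∈ s then a j else 0 := by
  induction s using Finset.induction_on with
  | empty => rfl
  | insert i s hi ih =>
    rw [Finset.sum_insert hi, coeff_add, ih, coeff_single]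
    by_cases hj : j = i
    · simp [hj, hi]
    · simp [hj]

theorem coeff_single_zero_mul (a : A) (S : FormalOp A δ) (m : ℤ) :
    (single 0 a * S).coeff m = a * S.coeff m := by
  rw [coeff_mul, finsum_eq_single _ ((0 : ℤ), 0)]
  · simp [mulTerm, coeff_single]
  · rintro ⟨i, p⟩ h
    by_cases hi : i = 0
    · subst hi
      have hp : 0 < p := Nat.pos_of_ne_zero fun hp => h (by rw [hp])
      simp [mulTerm, Ring.choose_zero_pos ℤ hp]
    · simp [mulTerm, coeff_single, hi]

theorem single_zero_mul_single (a b : A) (i : ℤ) :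
    (single 0 a * single i b : FormalOp A δ) = single i (a * b) := by
  ext j
  rw [coeff_single_zero_mul, coeff_single, coeff_single, mul_ite, mul_zero]

theorem coeff_single_one_mul (a : A) (S : FormalOp A δ) (m : ℤ) :
    (single 1 a * S).coeff m = a * S.coeff (m - 1) + a * δ (S.coeff m) := by
  rw [coeff_mul, finsum_eq_sum_of_support_subset (s := {((1 : ℤ), 0), ((1 : ℤ), 1)})]
  · rw [Finset.sum_pair (by simp)]
    simp [mulTerm, coeff_single]
  · rintro ⟨i, p⟩ h
    by_contra hc
    apply h
    by_cases hi : i = 1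
    · subst hi
      have hp : 1 < p := by
        by_contra hp
        interval_cases p <;> simp at hc
      have hchoose : Ring.choose (1 : ℤ) p = 0 := by
        simpa [Nat.choose_eq_zero_of_lt hp] using Ring.choose_natCast (R := ℤ) 1 p
      simp [mulTerm, hchoose]
    · simp [mulTerm, coeff_single, hi]

theorem single_one_mul_single (a b : A) (j : ℤ) :
    (single 1 a * single j b : FormalOp A δ) = single (j + 1) (a * b) + single j (a * δ b) := by
  ext m
  simp only [coeff_single_one_mul, coeff_add, coeff_single, sub_eq_iff_eq_add, apply_ite δ,
    map_zero, mul_ite, mul_zero]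

theorem coeff_mul_eq_zero {S T : FormalOp A δ} {a b m : ℤ} (ha : ∀ i, a < i → S.coeff i = 0)
    (hb : ∀ i, b < i → T.coeff i = 0) (hm : a + b < m) : (S * T).coeff m = 0 :=
  finsum_eq_zero_of_forall_eq_zero fun s => mulTerm_eq_zero ha hb m s (by omega)

theorem coeff_mul_congr {S S' T : FormalOp A δ} {b m : ℤ} (hb : ∀ i, b < i → T.coeff i = 0)
    (h : ∀ i, m - b ≤ i → S.coeff i = S'.coeff i) : (S * T).coeff m = (S' * T).coeff m :=
  finsum_congr fun s => by
    by_cases hs : m - b ≤ s.1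
    · rw [mulTerm, mulTerm, h _ hs]
    · rw [mulTerm, mulTerm, hb _ (by omega), iterate_map_zero, mul_zero, mul_zero]

theorem mapCoeff_mul {e : A →+ A} (he : IsLeibniz e) (hcomm : ∀ a, e (δ a) = δ (e a))
    (S T : FormalOp A δ) : mapCoeff e (S * T) = mapCoeff e S * T + S * mapCoeff e T := by
  have hiter : ∀ (p : ℕ) a, e (δ^[p] a) = δ^[p] (e a) := fun p =>
    Function.Commute.iterate_right (f := e) (g := δ) hcomm p
  ext m
  rw [coeff_add, coeff_mapCoeff, coeff_mul, coeff_mul, coeff_mul,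
    ← finsum_add_distrib (finite_support_mulTerm _ _ m) (finite_support_mulTerm _ _ m),
    AddMonoidHom.map_finsum _ (finite_support_mulTerm S T m)]
  refine finsum_congr fun s => ?_
  simp only [mulTerm, coeff_mapCoeff, map_zsmul, he _ _, hiter, smul_add]

/-- The series `∑ aᵢ ∂ⁱ⁺¹`, which is the composition of `∑ aᵢ ∂ⁱ` with `∂` on the right. -/
def shift (S : FormalOp A δ) : FormalOp A δ where
  coeff i := S.coeff (i - 1)
  bounded := by
    obtain ⟨m, hm⟩ := S.bounded
    exact ⟨m + 1, fun i hi => hm _ (by omega)⟩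

theorem coeff_shift (S : FormalOp A δ) (i : ℤ) : (shift S).coeff i = S.coeff (i - 1) := rfl

theorem mulTerm_shift_zero (S T : FormalOp A δ) (m i : ℤ) :
    mulTerm (shift S) T m (i + 1, 0) = mulTerm S T (m - 1) (i, 0) := by
  simp [mulTerm, coeff_shift, sub_sub, add_comm]

theorem mulTerm_shift_succ (S T : FormalOp A δ) (m i : ℤ) (p : ℕ) :
    mulTerm (shift S) T m (i + 1, p + 1) =
      mulTerm S T (m - 1) (i, p + 1) + mulTerm S (mapCoeff δ T) m (i, p) := by
  have hleft : m - (i + 1) + ((p + 1 : ℕ) : ℤ) = m - i + p := by push_cast; ring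
  have hright : m - 1 - i + ((p + 1 : ℕ) : ℤ) = m - i + p := by push_cast; ring
  simp only [mulTerm, coeff_shift, coeff_mapCoeff, hleft, hright, add_sub_cancel_right,
    ← Function.iterate_succ_apply, Ring.choose_succ_succ, add_smul]
  rw [add_comm]

/-- With `shift S = S ∂` and `shift T + δ(T) = ∂ T`, this is `(S ∂) T = S (∂ T)`. Pascal's rule is
what makes it true. -/
theorem shift_mul (S T : FormalOp A δ) : shift S * T = shift (S * T) + S * mapCoeff δ T := by
  ext m
  have hfin : (Function.support fun s : ℤ × ℕ => mulTerm (shift S) T m (s.1 + 1, s.2)).Finite :=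
    (finite_support_mulTerm (shift S) T m).preimage
      ((Equiv.addRight (1 : ℤ)).prodCongr (Equiv.refl ℕ)).injective.injOn
  have hfin' : (Function.support fun s : ℤ × ℕ => mulTerm S T (m - 1) (s.1, s.2 + 1)).Finite :=
    (finite_support_mulTerm S T (m - 1)).preimage
      (Function.injective_id.prodMap (add_left_injective 1)).injOn
  calc (shift S * T).coeff m = ∑ᶠ s : ℤ × ℕ, mulTerm (shift S) T m (s.1 + 1, s.2) :=
        (finsum_comp_equiv ((Equiv.addRight (1 : ℤ)).prodCongr (Equiv.refl ℕ))).symm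
    _ = ∑ᶠ i : ℤ, mulTerm S T (m - 1) (i, 0) + ∑ᶠ s : ℤ × ℕ,
          (mulTerm S T (m - 1) (s.1, s.2 + 1) + mulTerm S (mapCoeff δ T) m s) := by
        rw [finsum_prod_nat_eq_zero_add hfin]
        simp only [mulTerm_shift_zero, mulTerm_shift_succ]
    _ = (S * T).coeff (m - 1) + (S * mapCoeff δ T).coeff m := by
        rw [finsum_add_distrib hfin' (finite_support_mulTerm _ _ m), ← add_assoc,
          ← finsum_prod_nat_eq_zero_add (finite_support_mulTerm S T (m - 1))]
        rfl
    _ = (shift (S * T) + S * mapCoeff δ T).coeff m := rfl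

end NonUnitalNonAssoc

section NonAssoc

variable {A : Type*} [NonAssocRing A] {δ : A →+ A}

theorem single_zero_one_mul (S : FormalOp A δ) : single 0 1 * S = S := by
  ext m
  rw [coeff_single_zero_mul, one_mul]

theorem single_one_one_mul (S : FormalOp A δ) : single 1 1 * S = shift S + mapCoeff δ S := by
  ext m
  rw [coeff_single_one_mul, one_mul, one_mul]
  rfl

theorem single_one_one_mul_injective :
    Function.Injective fun S : FormalOp A δ => single 1 1 * S := by
  intro S T h
  obtain ⟨a, ha⟩ := S.bounded
  obtain ⟨b, hb⟩ := T.bounded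
  have hcoeff : ∀ (n : ℕ) (i : ℤ), max a b < i + n → S.coeff i = T.coeff i := by
    intro n
    induction n with
    | zero => exact fun i hi => by rw [ha i (by omega), hb i (by omega)]
    | succ n ih =>
      intro i hi
      have hsucc := congrArg (fun X => X.coeff (i + 1)) h
      simp only [coeff_single_one_mul, one_mul, add_sub_cancel_right] at hsucc
      rw [ih (i + 1) (by push_cast at hi; omega)] at hsucc
      exact add_right_cancel hsucc
  ext i
  exact hcoeff (max a b + 1 - i).toNat i (by omega)

theorem mul_single_zero_one (hδ : IsLeibniz δ) (S : FormalOp A δ) : S * single 0 1 = S := by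
  ext m
  rw [coeff_mul, finsum_eq_single _ (m, 0)]
  · simp [mulTerm, coeff_single]
  · rintro ⟨i, _ | p⟩ h
    · have hi : m - i ≠ 0 := fun hi => h (by rw [Prod.mk.injEq]; exact ⟨by omega, rfl⟩)
      simp [mulTerm, coeff_single, hi]
    · simp [mulTerm, coeff_single, apply_ite δ, hδ.map_one, iterate_map_zero]

theorem single_one_one_mul_single_one (hδ : IsLeibniz δ) (i : ℤ) :
    (single 1 1 * single i 1 : FormalOp A δ) = single (i + 1) 1 := by
  rw [single_one_mul_single, one_mul, one_mul, hδ.map_one, single_zero_right, add_zero]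

theorem single_one_one_mul_mul (hδ : IsLeibniz δ) (S T : FormalOp A δ) :
    single 1 1 * S * T = single 1 1 * (S * T) := by
  rw [single_one_one_mul, single_one_one_mul, right_distrib, shift_mul,
    mapCoeff_mul hδ fun _ => rfl, add_assoc, add_comm (S * _)]

end NonAssoc

section Assoc

variable {A : Type*} [Ring A] {δ : A →+ A}

theorem single_zero_mul_mul (a : A) (S T : FormalOp A δ) :
    single 0 a * S * T = single 0 a * (S * T) := by
  ext m
  rw [coeff_single_zero_mul, coeff_mul, coeff_mul, mul_finsum' _ _ (finite_support_mulTerm S T m)]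
  refine finsum_congr fun s => ?_
  rw [mulTerm, mulTerm, coeff_single_zero_mul, mul_assoc, mul_smul_comm]

theorem single_mul_mul (hδ : IsLeibniz δ) (i : ℤ) (a : A) (S T : FormalOp A δ) :
    single i a * S * T = single i a * (S * T) := by
  have hpow : single i 1 * S * T = single i 1 * (S * T) := by
    induction i with
    | zero => exact single_zero_mul_mul 1 S T
    | succ n ih =>
      rw [← single_one_one_mul_single_one hδ]
      simp only [single_one_one_mul_mul hδ, ih]
    | pred n ih =>
      rw [← sub_add_cancel (-(n : ℤ)) 1, ← single_one_one_mul_single_one hδ] at ih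
      simp only [single_one_one_mul_mul hδ] at ih
      exact single_one_one_mul_injective ih
  rw [← mul_one a, ← single_zero_mul_single, single_zero_mul_mul, single_zero_mul_mul, hpow,
    single_zero_mul_mul]

/-- Each coefficient of `S T U` only involves finitely many coefficients of `S`, so `S` may be
replaced by a finite sum of monomials. -/
theorem mul_assoc_of_isLeibniz (hδ : IsLeibniz δ) (S T U : FormalOp A δ) :
    S * T * U = S * (T * U) := by
  ext m
  obtain ⟨a, ha⟩ := S.bounded
  obtain ⟨b, hb⟩ := T.bounded
  obtain ⟨c, hc⟩ := U.bounded
  let S' : FormalOp A δ := ∑ i ∈ Finset.Icc (m - c - b) a, single i (S.coeff i)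
  have hS' : ∀ i, m - c - b ≤ i → S.coeff i = S'.coeff i := fun i hi => by
    rw [coeff_sum_single]
    split_ifs with h
    · rfl
    · exact ha i (by rw [Finset.mem_Icc] at h; omega)
  have hassoc : S' * T * U = S' * (T * U) := by
    simp only [S', Finset.sum_mul, single_mul_mul hδ]
  have hST : ∀ i, m - c ≤ i → (S * T).coeff i = (S' * T).coeff i := fun i hi =>
    coeff_mul_congr hb fun j hj => hS' j (by omega)
  have hTU : ∀ i, b + c < i → (T * U).coeff i = 0 := fun i => coeff_mul_eq_zero hb hc
  rw [coeff_mul_congr hc hST, hassoc, coeff_mul_congr hTU fun i hi => hS' i (by omega)]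

end Assoc

section CommRing

variable {A : Type*} [CommRing A] {d : Derivation ℤ A A}

noncomputable instance : Ring (FormalOp A d.toLinearMap.toAddMonoidHom) :=
  { (inferInstance : NonUnitalNonAssocRing (FormalOp A d.toLinearMap.toAddMonoidHom)) with
    one := single 0 1
    mul_assoc := mul_assoc_of_isLeibniz (isLeibniz_derivation d)
    one_mul := single_zero_one_mul
    mul_one := mul_single_zero_one (isLeibniz_derivation d) }

theorem single_two_mul_single (a b : A) (j : ℤ) :
    (single 2 a * single j b : FormalOp A d.toLinearMap.toAddMonoidHom) =
      single (j + 2) (a * b) + single (j + 1) (2 * (a * d b)) + single j (a * d (d b)) := by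
  have htwo : (single 2 a : FormalOp A d.toLinearMap.toAddMonoidHom) = single 1 a * single 1 1 := by
    rw [single_one_mul_single, mul_one, (isLeibniz_derivation d).map_one, mul_zero,
      single_zero_right, add_zero]
    rfl
  rw [htwo, mul_assoc]
  simp only [mul_add, single_one_mul_single, one_mul, add_assoc j, one_add_one_eq_two]
  ext m
  simp only [coeff_add, coeff_single, LinearMap.toAddMonoidHom_coe, Derivation.coeFn_coe]
  split_ifs <;> ring

theorem single_neg_one_mul_single_one :
    (single (-1) 1 * single 1 1 : FormalOp A d.toLinearMap.toAddMonoidHom) = 1 := by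
  refine single_one_one_mul_injective ?_
  change single 1 1 * (single (-1) 1 * single 1 1) = single 1 1 * 1
  rw [← mul_assoc, single_one_one_mul_single_one (isLeibniz_derivation d), mul_one]
  exact one_mul _

theorem single_two_add_mul_sub_single_one_sq_mul (f : A) :
    (single 2 (f ^ 2) + single 0 (2 * f * d (d f))) * single 1 (f ^ 2) -
        single 1 (f ^ 2) * (single 1 1 * single 1 (f ^ 2)) =
      (single 1 (2 * f * (f ^ 2 * d (d f))) : FormalOp A d.toLinearMap.toAddMonoidHom) := by
  rw [sub_eq_iff_eq_add]
  simp only [add_mul, mul_add, single_zero_mul_single, single_one_mul_single, single_two_mul_single,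
    Int.reduceAdd]
  ext m
  simp only [coeff_add, coeff_single, LinearMap.toAddMonoidHom_coe, Derivation.coeFn_coe, pow_two,
    Derivation.leibniz, Derivation.map_one_eq_zero, smul_eq_mul, map_add, mul_zero]
  split_ifs <;> ring

theorem commutator_single_one_sq (f : A) :
    (single 1 1 * single 1 (f ^ 2)) * (single 1 1 * single 0 f) -
        (single 1 1 * single 0 f) * (single 1 1 * single 1 (f ^ 2)) =
      (single 1 1 * single 0 (f ^ 2 * d (d f)) : FormalOp A d.toLinearMap.toAddMonoidHom) := by
  rw [sub_eq_iff_eq_add]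
  simp only [add_mul, mul_add, single_zero_mul_single, single_one_mul_single, single_two_mul_single,
    Int.reduceAdd]
  ext m
  simp only [coeff_add, coeff_single, LinearMap.toAddMonoidHom_coe, Derivation.coeFn_coe, pow_two,
    Derivation.leibniz, Derivation.map_one_eq_zero, smul_eq_mul, map_add, map_zero, mul_zero]
  split_ifs <;> ring

theorem recursion_mul_single_one_sq {f g : A} (hg : g * f ^ 2 = 1) :
    (single 0 f * single 1 1 + single 0 (f ^ 2 * d (d f)) * (single (-1) 1 * single 0 g)) *
        single 1 (f ^ 2) =
      (single 1 (f ^ 2) * (single 1 1 * single 0 f) :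
        FormalOp A d.toLinearMap.toAddMonoidHom) := by
  have hcancel : (single (-1) 1 * single 0 g * single 1 (f ^ 2) :
      FormalOp A d.toLinearMap.toAddMonoidHom) = 1 := by
    rw [mul_assoc, single_zero_mul_single, hg, single_neg_one_mul_single_one]
  rw [add_mul, mul_assoc (single 0 (f ^ 2 * d (d f))), hcancel, mul_one]
  simp only [mul_add, single_zero_mul_single, single_one_mul_single, Int.reduceAdd]
  ext m
  simp only [coeff_add, coeff_single, LinearMap.toAddMonoidHom_coe, Derivation.coeFn_coe, pow_two,
    Derivation.leibniz, Derivation.map_one_eq_zero, smul_eq_mul, mul_zero]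
  split_ifs <;> ring

end CommRing

end FormalOp

namespace DiffFunField

section Root

variable {K : Type*} [Field K] [DiffFunField K]

theorem pd_root (i : ℕ) : pd i (u 0 ^ 2 * u 2 : K) =
    (if i = 2 then u 0 ^ 2 else 0) + (if i = 0 then 2 * u 0 * u 2 else 0) := by
  simp only [pow_two, Derivation.leibniz, pd_u, smul_eq_mul]
  split_ifs <;> ring

theorem prolong_root (Q : K) : prolong Q (u 0 ^ 2 * u 2 : K) =
    u 0 ^ 2 * Dx K (Dx K Q) + 2 * u 0 * u 2 * Q := by
  simp only [prolong, pow_two, Derivation.leibniz, vertical_u, smul_eq_mul,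
    Function.iterate_succ_apply', Function.iterate_zero_apply]
  ring

theorem Dt_root_u_zero : Dt (u 0 ^ 2 * u 2 : K) (u 0) = u 0 ^ 2 * u 2 := Dt_u _ 0

theorem Dt_root_u_zero_sq :
    Dt (u 0 ^ 2 * u 2 : K) (u 0 ^ 2) = 2 * u 0 * (u 0 ^ 2 * u 2) := by
  rw [Derivation.leibniz_pow, Dt_root_u_zero, smul_eq_mul, nsmul_eq_mul, Nat.cast_ofNat, pow_one,
    mul_assoc]

end Root

section Commutation

open FormalOp

variable {K : Type*} [Field K] [DiffFunField K]

theorem frechetEq_mul_single_zero {F : K} {R : PseudoDiff K}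
    (h : mapCoeff (Dt F).toLinearMap.toAddMonoidHom R = frechet F * R - R * frechet F) :
    frechetEq F * single 0 R = single 0 R * frechetEq F := by
  have hone_mul : ∀ S : PseudoDiff K, single 0 1 * S = S := one_mul
  have hmul_one : R * (single 0 1 : PseudoDiff K) = R := mul_one R
  ext1
  funext m
  simp only [frechetEq, add_mul, mul_add, neg_mul, mul_neg, single_zero_mul_single,
    single_one_mul_single, hone_mul, hmul_one, h, zero_add, coeff_add, coeff_neg, coeff_single]
  split_ifs <;> abel

theorem isLeibniz_mapCoeff_Dt (F : K) :
    IsLeibniz (mapCoeff (δ := (Dx K).toLinearMap.toAddMonoidHom)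
      (Dt F).toLinearMap.toAddMonoidHom) :=
  mapCoeff_mul (isLeibniz_derivation (Dt F)) (Dt_Dx F)

theorem frechet_root : frechet (u 0 ^ 2 * u 2 : K) =
    single 2 (u 0 ^ 2) + single 0 (2 * u 0 * u 2) := by
  ext i
  change (if 0 ≤ i then pd i.toNat (u 0 ^ 2 * u 2 : K) else 0) = _
  rw [coeff_add, coeff_single, coeff_single, pd_root]
  by_cases hi : 0 ≤ i
  · lift i to ℕ using hi
    norm_cast
  · rw [if_neg hi, if_neg (by omega), if_neg (by omega), add_zero]

theorem mapCoeff_Dt_recOp :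
    mapCoeff (Dt (u 0 ^ 2 * u 2 : K)).toLinearMap.toAddMonoidHom (recOp K).toOp =
      frechet (u 0 ^ 2 * u 2 : K) * (recOp K).toOp -
        (recOp K).toOp * frechet (u 0 ^ 2 * u 2 : K) := by
  have hu : (u 0 : K) ^ 2 ≠ 0 := pow_ne_zero 2 (u_ne_zero 0)
  have hDDu : Dx K (Dx K (u 0)) = (u 2 : K) := by rw [Dx_u, Dx_u]
  have hDt := isLeibniz_mapCoeff_Dt (u 0 ^ 2 * u 2 : K)
  have hDt_one : mapCoeff (Dt (u 0 ^ 2 * u 2 : K)).toLinearMap.toAddMonoidHom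
      (single 1 1 : PseudoDiff K) = 0 := by
    rw [mapCoeff_single, (isLeibniz_derivation _).map_one, single_zero_right]
  have hinv : (single 1 (u 0 ^ 2) * (single (-1) 1 * single 0 (1 / u 0 ^ 2)) : PseudoDiff K) =
      1 := by
    rw [← mul_assoc, single_one_mul_single, (isLeibniz_derivation _).map_one, mul_zero,
      single_zero_right, add_zero, mul_one]
    exact (single_zero_mul_single _ _ 0).trans (by rw [mul_one_div_cancel hu]; rfl)
  refine hDt.eq_commutator_of_intertwine (L := single 1 1 * single 1 (u 0 ^ 2))
    (T := single 1 1 * single 0 (u 0)) hinv ?_ ?_ ?_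
  · have h := single_two_add_mul_sub_single_one_sq_mul (d := Dx K) (u 0)
    rw [hDDu] at h
    rw [frechet_root, h, mapCoeff_single]
    exact congrArg _ Dt_root_u_zero_sq
  · have h := commutator_single_one_sq (d := Dx K) (u 0)
    rw [hDDu] at h
    rw [h, hDt, hDt_one, zero_mul, zero_add, mapCoeff_single]
    exact congrArg (fun a => single 1 1 * single 0 a) Dt_root_u_zero
  · have h := recursion_mul_single_one_sq (d := Dx K) (one_div_mul_cancel hu)
    rw [hDDu] at h
    exact h

end Commutation

section Recursion

variable {K : Type*} [Field K] [DiffFunField K]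

theorem recOp_acts_iff {Q Q' : K} : (recOp K).Acts Q Q' ↔
    ∃ w, Q = u 0 ^ 2 * Dx K w ∧ Q' = u 0 ^ 2 * Dx K (Dx K (u 0 * w)) := by
  have hu : (u 0 : K) ≠ 0 := u_ne_zero 0
  have hvalue : ∀ w : K, u 0 * Dx K (u 0 ^ 2 * Dx K w) + u 0 ^ 2 * u 2 * w =
      u 0 ^ 2 * Dx K (Dx K (u 0 * w)) := fun w => by
    simp only [pow_two, Derivation.leibniz, map_add, Dx_u, smul_eq_mul]
    ring
  constructor
  · rintro ⟨_, _, ⟨_, rfl, rfl⟩, ⟨w, ⟨_, rfl, hw⟩, rfl⟩, rfl⟩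
    change Dx K w = 1 / u 0 ^ 2 * Q at hw
    have hQ : Q = u 0 ^ 2 * Dx K w := by
      rw [hw]
      field_simp
    exact ⟨w, hQ, by rw [← hvalue, ← hQ]⟩
  · rintro ⟨w, rfl, rfl⟩
    refine ⟨_, _, ⟨_, rfl, rfl⟩, ⟨w, ⟨_, rfl, ?_⟩, rfl⟩, (hvalue w).symm⟩
    change Dx K w = 1 / u 0 ^ 2 * (u 0 ^ 2 * Dx K w)
    field_simp

/-- Solutions `w` of the potential form `w_t = D_x(u² D_x w)` of the symmetry condition for
`u_t = u² u₂`: then `u² D_x w` is a symmetry. -/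
def IsPotential (w : K) : Prop := Dt (u 0 ^ 2 * u 2) w = Dx K (u 0 ^ 2 * Dx K w)

theorem IsPotential.isSymmetry {w : K} (hw : IsPotential w) :
    IsSymmetry (u 0 ^ 2 * u 2) (u 0 ^ 2 * Dx K w) := by
  have hDt : Dt (u 0 ^ 2 * u 2) (u 0 ^ 2 * Dx K w) =
      u 0 ^ 2 * Dx K (Dx K (u 0 ^ 2 * Dx K w)) + 2 * u 0 * (u 0 ^ 2 * u 2) * Dx K w := by
    rw [Derivation.leibniz, Dt_Dx, hw, Dt_root_u_zero_sq, smul_eq_mul, smul_eq_mul,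
      mul_comm (Dx K w)]
  rw [IsSymmetry, prolong_root, hDt]
  ring

theorem IsPotential.of_Dx_eq {v w : K} (hw : IsPotential w) (h : Dx K v = Dx K w) :
    IsPotential v := by
  have hDt : Dt (u 0 ^ 2 * u 2) (v - w) = 0 :=
    Dt_eq_zero_of_Dx_eq_zero _ (by rw [map_sub, h, sub_self])
  rw [IsPotential, h, ← hw]
  rwa [map_sub, sub_eq_zero] at hDt

theorem IsPotential.Dx_u_mul {w : K} (hw : IsPotential w) : IsPotential (Dx K (u 0 * w)) := by
  have hDt : Dt (u 0 ^ 2 * u 2) (u 0 * w) = u 0 ^ 2 * Dx K (Dx K (u 0 * w)) := by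
    rw [Derivation.leibniz, Dt_root_u_zero, hw]
    simp only [pow_two, Derivation.leibniz, map_add, Dx_u, smul_eq_mul]
    ring
  rw [IsPotential, Dt_Dx, hDt]

theorem isPotential_u_one : IsPotential (u 1 : K) := by
  have hone : IsPotential (1 : K) := by simp [IsPotential]
  simpa [Dx_u] using hone.Dx_u_mul

theorem exists_isPotential {Q : K} (h : Relation.ReflTransGen (recOp K).Acts (u 0 ^ 2 * u 2) Q) :
    ∃ w, IsPotential w ∧ Q = u 0 ^ 2 * Dx K w := by
  induction h with
  | refl => exact ⟨u 1, isPotential_u_one, by rw [Dx_u]⟩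
  | tail _ hstep ih =>
    obtain ⟨w, hw, rfl⟩ := ih
    obtain ⟨v, hv, rfl⟩ := recOp_acts_iff.1 hstep
    have hDx : Dx K v = Dx K w := (mul_left_cancel₀ (pow_ne_zero 2 (u_ne_zero 0)) hv).symm
    exact ⟨_, (hw.of_Dx_eq hDx).Dx_u_mul, rfl⟩

theorem isRecursionOperator_recOp :
    IsRecursionOperator (u 0 ^ 2 * u 2 : K) (recOp K) (u 0 ^ 2 * u 2) := fun Q hQ => by
  obtain ⟨w, hw, rfl⟩ := exists_isPotential hQ
  exact ⟨hw.isSymmetry, _, recOp_acts_iff.2 ⟨w, rfl, rfl⟩⟩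

theorem recOp_acts_root_iff (Q : K) : (recOp K).Acts (u 0 ^ 2 * u 2) Q ↔
    ∃ c : K, Dx K c = 0 ∧
      Q = u 0 ^ 2 * (3 * u 1 * u 2 + u 0 * u 3) + c * (u 0 ^ 2 * u 2) := by
  have hvalue : ∀ c : K, Dx K c = 0 → u 0 ^ 2 * Dx K (Dx K (u 0 * (u 1 + c))) =
      u 0 ^ 2 * (3 * u 1 * u 2 + u 0 * u 3) + c * (u 0 ^ 2 * u 2) := fun c hc => by
    simp only [Derivation.leibniz, map_add, Dx_u, hc, smul_eq_mul, add_zero]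
    ring
  rw [recOp_acts_iff]
  constructor
  · rintro ⟨w, hw, rfl⟩
    have hDx : Dx K w = u 2 := (mul_left_cancel₀ (pow_ne_zero 2 (u_ne_zero 0)) hw).symm
    have hc : Dx K (w - u 1) = 0 := by rw [map_sub, hDx, Dx_u, sub_self]
    exact ⟨w - u 1, hc, by rw [← hvalue _ hc, add_sub_cancel]⟩
  · rintro ⟨c, hc, rfl⟩
    exact ⟨u 1 + c, by rw [map_add, hc, add_zero, Dx_u], (hvalue c hc).symm⟩

theorem order_u_zero_mul {f : K} (hf : 0 < order f) : order (u 0 * f) = order f :=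
  order_mul_of_order_lt (u_ne_zero 0) ((order_u 0).trans_lt hf)

theorem order_u_zero_sq_mul {f : K} (hf : 0 < order f) : order (u 0 ^ 2 * f) = order f := by
  rw [pow_two, mul_assoc, order_u_zero_mul ((order_u_zero_mul hf).symm ▸ hf), order_u_zero_mul hf]

theorem order_u_zero_sq_mul_le (f : K) : order (u 0 ^ 2 * f) ≤ max 0 (order f) := by
  have hsq : order (u 0 ^ 2 : K) ≤ 0 := by
    rw [pow_two]
    exact (order_mul_le _ _).trans (by rw [max_self, order_u]; rfl)
  exact (order_mul_le _ _).trans (max_le_max_right _ hsq)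

theorem order_eq_add_one_of_recOp_acts {Q Q' : K} (hQ : 1 < order Q) (h : (recOp K).Acts Q Q') :
    order Q' = order Q + 1 := by
  obtain ⟨w, rfl, rfl⟩ := recOp_acts_iff.1 h
  have hDx : 1 < order (Dx K w) :=
    (lt_max_iff.1 (hQ.trans_le (order_u_zero_sq_mul_le _))).resolve_left (by decide)
  have hw : 0 < order w := by
    rw [order_Dx] at hDx
    exact lt_of_add_lt_add_right ((zero_add (1 : WithBot ℕ)).trans_lt hDx)
  have hpos : ∀ f : K, 0 < order f → 0 < order (Dx K f) := fun f hf =>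
    (lt_add_of_lt_of_nonneg hf zero_le_one).trans_eq (order_Dx f).symm
  have huw : 0 < order (u 0 * w) := hw.trans_eq (order_u_zero_mul hw).symm
  rw [order_u_zero_sq_mul (hpos _ hw), order_u_zero_sq_mul (hpos _ (hpos _ huw)), order_Dx,
    order_Dx, order_Dx, order_u_zero_mul hw]

theorem strictMono_order {Q : ℕ → K} (h0 : Q 0 = u 0 ^ 2 * u 2)
    (hQ : ∀ j, (recOp K).Acts (Q j) (Q (j + 1))) : StrictMono fun j => order (Q j) := by
  have horder : ∀ j, order (Q j) = (j + 2 : ℕ) := by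
    intro j
    induction j with
    | zero =>
      rw [h0, order_u_zero_sq_mul] <;> rw [order_u]
      norm_num
    | succ j ih =>
      have hlt : 1 < order (Q j) := by
        rw [ih]
        exact_mod_cast (by omega : 1 < j + 2)
      rw [order_eq_add_one_of_recOp_acts hlt (hQ j), ih]
      rfl
  exact strictMono_nat_of_lt_succ fun j => by
    rw [horder, horder]
    exact_mod_cast (by omega : j + 2 < j + 1 + 2)

end Recursion

end DiffFunField

theorem mainTheorem3 {K : Type*} [Field K] [DiffFunField K] :
    -- the Fréchet derivative of the right-hand side `u² u₂` is `u² D_x² + 2 u u₂`,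
    frechet (u 0 ^ 2 * u 2 : K)
        = FormalOp.single 2 (u 0 ^ 2) + FormalOp.single 0 (2 * u 0 * u 2) ∧
    -- `R` commutes on solutions with the Fréchet derivative `D_Δ` of the equation,
    frechetEq (u 0 ^ 2 * u 2 : K) * FormalOp.single 0 (recOp K).toOp
        = FormalOp.single 0 (recOp K).toOp * frechetEq (u 0 ^ 2 * u 2 : K) ∧
    -- `R` is a recursion operator with root `u² u₂` for `u_t = u² u₂`,
    IsRecursionOperator (u 0 ^ 2 * u 2 : K) (recOp K) (u 0 ^ 2 * u 2) ∧
    -- the characteristics `Q₁ = u² u₂, Q₂ = R Q₁, …` (here `Q 0, Q 1, …`) have increasing orders,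
    (∀ Q : ℕ → K, Q 0 = u 0 ^ 2 * u 2 → (∀ j, (recOp K).Acts (Q j) (Q (j + 1))) →
      StrictMono fun j => order (Q j)) ∧
    -- and `Q₂ = u² (3 u₁ u₂ + u u₃)`, up to the constant of integration.
    (∀ Q₂ : K, (recOp K).Acts (u 0 ^ 2 * u 2) Q₂ ↔
      ∃ c : K, Dx K c = 0 ∧
        Q₂ = u 0 ^ 2 * (3 * u 1 * u 2 + u 0 * u 3) + c * (u 0 ^ 2 * u 2)) := by
  exact ⟨frechet_root, frechetEq_mul_single_zero mapCoeff_Dt_recOp, isRecursionOperator_recOp,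
    fun _ => strictMono_order, recOp_acts_root_iff⟩
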